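/- Let $n,q,r,p$ be nonnegative integers. In the vector autoregression with predictors (VARX), for $t=1,\dots,n$, $$Y_t=\sum_{i=1}^q\mathcal A_i^{\mathsf T}Y_{t-i}+\mathcal B^{\mathsf T}X_t+U_t,\qquad U_1,\dots,U_n\ \text{i.i.d. } N(0,\Sigma),$$ with $Y_t\in\mathbb R^r$, $X_t\in\mathbb R^p$, $\mathcal A_i\in\mathbb R^{r\times r}$, $\mathcal B\in\mathbb R^{p\times r}$ and $\Sigma$ in the set $\mathbb S^r_{++}$ of symmetric positive definite $r\times r$ matrices. The starting values $Y_{-q+1},\dots,Y_0$ are known, and the predictors are independent of the innovations with a distribution that does not depend on the parameters. Write $Y=[Y_1,\dots,Y_n]^{\mathsf T}$, $X=[X_1,\dots,X_n]^{\mathsf T}$, $Z=[Z_1,\dots,Z_n]^{\mathsf T}$ with $Z_t=[Y_{t-1}^{\mathsf T},\dots,Y_{t-q}^{\mathsf T}]^{\mathsf T}$, $\mathcal A=[\mathcal A_1^{\mathsf T},\dots,\mathcal A_q^{\mathsf T}]^{\mathsf T}\in\mathbb R^{qr\times r}$ and $\alpha=\operatorname{vec}(\mathcal A)$. The likelihood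 is $f(Y,X\mid\alpha,\mathcal B,\Sigma)=f(X)\prod_{t=1}^n\phi_\Sigma(Y_t-\mathcal A^{\mathsf T}Z_t-\mathcal B^{\mathsf T}X_t)$, where $\phi_\Sigma$ is the $N(0,\Sigma)$ density and $f(X)>0$ is the density of the predictors at the observed $X$. Let $a\ge 0$ and let $D$ be a symmetric positive semidefinite $r\times r$ matrix. The prior on $\Theta=\mathbb R^{qr^2}\times\mathbb R^{p\times r}\times\mathbb S^r_{++}$ has density $f(\alpha)f(\mathcal B)f(\Sigma)$ with respect to Lebesgue measure (with $d\Sigma=\prod_{i\le j}d\Sigma_{ij}$), where $f(\mathcal B)\propto 1$, $f(\Sigma)\propto|\Sigma|^{-a/2}\operatorname{etr}(-\tfrac12D\Sigma^{-1})$, $\operatorname{etr}(\cdot)=\exp(\operatorname{tr}(\cdot))$, and $f(\alpha)$ is nonnegative, measurable and not almost everywhere zero. All proportionality constants are positive. The prior $f(\alpha)$ is called proper if its integral is finite; the posterior is called proper if the integral over $\Theta$ of likelihood times prior is positive and finite, so that the normalized product is a probability density. Suppose that the fixed data $(Y,X)$ and starting values satisfy at least one of the following: 1. $D$ is positive definite,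 $X$ has full column rank, $n+a>2r+p$, and $f(\alpha)$ is proper; 2. $[Y,Z,X]\in\mathbb R^{n\times(r+qr+p)}$ has full column rank, $n+a>(2+q)r+p$, and $f(\alpha)$ is bounded. Then the posterior distribution is proper. If, in addition, $f(\alpha)\propto\exp(-\tfrac12[\alpha-m]^{\mathsf T}C[\alpha-m])$ for some $m\in\mathbb R^{qr^2}$ and some symmetric positive semidefinite $C\in\mathbb R^{qr^2\times qr^2}$, then, with $S=n^{-1}(Y-Z\mathcal A-X\mathcal B)^{\mathsf T}(Y-Z\mathcal A-X\mathcal B)$ (and $nS=0$ if $n=0$), the posterior density satisfies, as a function on $\Theta$, $$f(\mathcal A,\mathcal B,\Sigma\mid Y,X)\propto|\Sigma|^{-\frac{n+a}{2}}\exp\!\left(-\tfrac12\operatorname{tr}\!\left(\Sigma^{-1}[D+nS]\right)-\tfrac12(\alpha-m)^{\mathsf T}C(\alpha-m)\right).$$ -/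

import Mathlib

open MeasureTheory
open scoped ENNReal Matrix

noncomputable section

namespace VARX

/-! ### Data and design matrices -/

/-- The observed data: the known starting values `Y_0, Y_{-1}, …, Y_{-q+1}` (`start j` is
`Y_{-j}`), the responses `Y = [Y_1, …, Y_n]ᵀ` and the predictors `X = [X_1, …, X_n]ᵀ`.
Row `t : Fin n` (counted from 0) belongs to time `t + 1`. -/
structure Data (n q r p : ℕ) where
  start : Fin q → Fin r → ℝ
  Y : Matrix (Fin n) (Fin r) ℝ
  X : Matrix (Fin n) (Fin p) ℝ

variable {n q r p : ℕ}

/-- The lagged response: for row `t` (time `t + 1`) and `i : Fin q` (lag `i + 1`) this is the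
observation at time `(t + 1) - (i + 1) = t - i`, which is row `t - i - 1` of `Y` if `i < t`, and
the starting value `Y_{-(i - t)}` if `t ≤ i`. -/
def Data.lag (d : Data n q r p) (t : Fin n) (i : Fin q) : Fin r → ℝ :=
  if (i : ℕ) < (t : ℕ) then d.Y ⟨(t : ℕ) - i - 1, by omega⟩
  else d.start ⟨(i : ℕ) - t, by omega⟩

/-- The `n × qr` matrix `Z` whose row for time `t` is `[Y_{t-1}ᵀ, …, Y_{t-q}ᵀ]`. -/
def Data.Z (d : Data n q r p) : Matrix (Fin n) (Fin q × Fin r) ℝ :=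
  Matrix.of fun t ij => d.lag t ij.1 ij.2

/-- The partitioned `n × (r + qr + p)` matrix `[Y, Z, X]`. -/
def Data.YZX (d : Data n q r p) :
    Matrix (Fin n) (Fin r ⊕ ((Fin q × Fin r) ⊕ Fin p)) ℝ :=
  Matrix.fromCols d.Y (Matrix.fromCols d.Z d.X)

/-- Full column rank: the columns are linearly independent. -/
def FullColumnRank {ι κ : Type*} (M : Matrix ι κ ℝ) : Prop :=
  LinearIndependent ℝ M.col

/-! ### The parameter space -/

/-- Entries of the coefficient `α = vec 𝒜 ∈ ℝ^{qr²}`, where `𝒜` is `qr × r`; the index order is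
that of `Matrix.vec`, so `α (k, (i, j))` is the entry of `𝒜` in row `(i, j)` and column `k`. -/
abbrev AlphaIdx (q r : ℕ) : Type := Fin r × (Fin q × Fin r)

/-- The positions on and above the diagonal of an `r × r` matrix. -/
abbrev UpperIdx (r : ℕ) : Type := {ij : Fin r × Fin r // ij.1 ≤ ij.2}

/-- Euclidean coordinates of `(α, ℬ, Σ)`: all entries of `α` and of `ℬ`, and the entries of the
symmetric matrix `Σ` on and above its diagonal. `volume` on this type is Lebesgue measure
`dα dℬ dΣ`, with `dΣ = ∏_{i ≤ j} dΣ_{ij}`. -/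
abbrev Param (q r p : ℕ) : Type :=
  (AlphaIdx q r → ℝ) × (Fin p → Fin r → ℝ) × (UpperIdx r → ℝ)

/-- The symmetric matrix with prescribed entries on and above the diagonal. -/
def symmetricMatrix (s : UpperIdx r → ℝ) : Matrix (Fin r) (Fin r) ℝ :=
  Matrix.of fun i j => s ⟨(min i j, max i j), min_le_max⟩

/-- The `qr × r` matrix with a given vectorization. -/
def unvec (α : AlphaIdx q r → ℝ) : Matrix (Fin q × Fin r) (Fin r) ℝ :=
  Matrix.of fun ij k => α (k, ij)

theorem vec_unvec (α : AlphaIdx q r → ℝ) : (unvec α).vec = α := rfl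

/-- The coordinate `α`. -/
def Param.alpha (θ : Param q r p) : AlphaIdx q r → ℝ := θ.1

/-- The `qr × r` matrix `𝒜 = [𝒜_1ᵀ, …, 𝒜_qᵀ]ᵀ`. -/
def Param.calA (θ : Param q r p) : Matrix (Fin q × Fin r) (Fin r) ℝ := unvec θ.1

/-- The lag coefficient matrices `𝒜_1, …, 𝒜_q`. -/
def Param.lagCoef (θ : Param q r p) (i : Fin q) : Matrix (Fin r) (Fin r) ℝ :=
  Matrix.of fun j k => θ.calA (i, j) k

/-- The `p × r` matrix `ℬ`. -/
def Param.calB (θ : Param q r p) : Matrix (Fin p) (Fin r) ℝ := Matrix.of θ.2.1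

/-- The innovation covariance matrix `Σ`. -/
def Param.Sig (θ : Param q r p) : Matrix (Fin r) (Fin r) ℝ := symmetricMatrix θ.2.2

/-- The parameter space `Θ = ℝ^{qr²} × ℝ^{p × r} × SPD(r)`, in coordinates. -/
def Theta (q r p : ℕ) : Set (Param q r p) := {θ | θ.Sig.PosDef}

/-! ### Likelihood -/

/-- The density at `u` of the `r`-variate normal distribution with mean zero and covariance `V`. -/
def normalDensity (V : Matrix (Fin r) (Fin r) ℝ) (u : Fin r → ℝ) : ℝ :=
  (2 * Real.pi) ^ (-(r : ℝ) / 2) * V.det ^ (-(1 : ℝ) / 2) * Real.exp (-(u ⬝ᵥ (V⁻¹ *ᵥ u)) / 2)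

/-- The innovation `U_t = Y_t - ∑ i, 𝒜_iᵀ Y_{t-i} - ℬᵀ X_t`. -/
def Data.innovation (d : Data n q r p) (θ : Param q r p) (t : Fin n) : Fin r → ℝ :=
  d.Y t - ∑ i : Fin q, (θ.lagCoef i)ᵀ *ᵥ d.lag t i - θ.calBᵀ *ᵥ d.X t

/-- The density `f(Y ∣ X, 𝒜, ℬ, Σ)`: the product over `t` of the one-step conditional densities of
`Y_t` given its past and `X`, which is normal with mean `∑ i, 𝒜_iᵀ Y_{t-i} + ℬᵀ X_t` and
covariance `Σ`. -/
def Data.condDensity (d : Data n q r p) (θ : Param q r p) : ℝ :=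
  ∏ t : Fin n, normalDensity θ.Sig (d.innovation θ t)

/-- The likelihood `f(Y, X ∣ 𝒜, ℬ, Σ) = f(X) f(Y ∣ X, 𝒜, ℬ, Σ)`, where `fX` is the density of the
strongly exogenous predictors, which does not depend on the parameters. -/
def Data.likelihood (d : Data n q r p) (fX : Matrix (Fin n) (Fin p) ℝ → ℝ)
    (θ : Param q r p) : ℝ :=
  fX d.X * d.condDensity θ

/-! ### Priors -/

/-- `f ∝ g` on the set `s`: equality up to a positive constant. -/
def ProportionalOn {β : Type*} (s : Set β) (f g : β → ℝ) : Prop :=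
  ∃ c : ℝ, 0 < c ∧ ∀ x ∈ s, f x = c * g x

/-- A possibly improper prior density with respect to Lebesgue measure: nonnegative, measurable
and not almost everywhere zero. -/
def IsPriorDensity {ι : Type*} [Fintype ι] (f : (ι → ℝ) → ℝ) : Prop :=
  Measurable f ∧ (∀ x, 0 ≤ f x) ∧ ¬ (∀ᵐ x, f x = 0)

/-- A prior density is proper if its integral is finite (so that it can be normalized). -/
def IsProperDensity {ι : Type*} [Fintype ι] (f : (ι → ℝ) → ℝ) : Prop :=
  IsPriorDensity f ∧ ∫⁻ x, ENNReal.ofReal (f x) < ∞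

/-- `etr M = exp (tr M)`. -/
def etr {ι : Type*} [Fintype ι] (M : Matrix ι ι ℝ) : ℝ := Real.exp M.trace

/-- The kernel `exp(-(α - m)ᵀ C (α - m) / 2)` of the normal prior on `α`. -/
def normalPriorKernel (m : AlphaIdx q r → ℝ) (C : Matrix (AlphaIdx q r) (AlphaIdx q r) ℝ)
    (α : AlphaIdx q r → ℝ) : ℝ :=
  Real.exp (-((α - m) ⬝ᵥ (C *ᵥ (α - m))) / 2)

/-- The kernel `|Σ|^{-a/2} etr(-D Σ⁻¹ / 2)` of the prior on `Σ`. -/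
def covPriorKernel (a : ℝ) (D V : Matrix (Fin r) (Fin r) ℝ) : ℝ :=
  V.det ^ (-a / 2) * etr (-(1 / 2 : ℝ) • (D * V⁻¹))

/-- The prior density `f(θ) = f(α) f(ℬ) f(Σ)`. -/
def priorDensity (fα : (AlphaIdx q r → ℝ) → ℝ) (fB : Matrix (Fin p) (Fin r) ℝ → ℝ)
    (fS : Matrix (Fin r) (Fin r) ℝ → ℝ) (θ : Param q r p) : ℝ :=
  fα θ.alpha * fB θ.calB * fS θ.Sig

/-! ### Posterior -/

/-- The marginal density of the data, `∫_Θ f(Y, X ∣ θ) f(θ) dθ ∈ [0, ∞]`. -/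
def evidence (lik prior : Param q r p → ℝ) : ℝ≥0∞ :=
  ∫⁻ θ in Theta q r p, ENNReal.ofReal (lik θ * prior θ)

/-- The posterior is proper if likelihood times prior can be normalized. -/
def PosteriorProper (lik prior : Param q r p → ℝ) : Prop :=
  0 < evidence lik prior ∧ evidence lik prior < ∞

/-- The posterior density by Bayes' formula (meaningful when the posterior is proper). -/
def posteriorDensity (lik prior : Param q r p → ℝ) (θ : Param q r p) : ℝ :=
  lik θ * prior θ / (evidence lik prior).toReal

/-- The posterior distribution, as a measure supported on `Θ`. -/
def posterior (lik prior : Param q r p → ℝ) : Measure (Param q r p) :=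
  (volume.restrict (Theta q r p)).withDensity
    fun θ => ENNReal.ofReal (posteriorDensity lik prior θ)

/-- `S = n⁻¹ (Y - Z𝒜 - Xℬ)ᵀ (Y - Z𝒜 - Xℬ)`. -/
def Data.S (d : Data n q r p) (θ : Param q r p) : Matrix (Fin r) (Fin r) ℝ :=
  (n : ℝ)⁻¹ • ((d.Y - d.Z * θ.calA - d.X * θ.calB)ᵀ * (d.Y - d.Z * θ.calA - d.X * θ.calB))

/-- `|Σ|^{-(n+a)/2} etr(-Σ⁻¹[D + nS]/2 - (α - m)ᵀ C (α - m)/2)`; the second term is a scalar. -/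
def Data.posteriorKernel (d : Data n q r p) (a : ℝ) (D : Matrix (Fin r) (Fin r) ℝ)
    (m : AlphaIdx q r → ℝ) (C : Matrix (AlphaIdx q r) (AlphaIdx q r) ℝ)
    (θ : Param q r p) : ℝ :=
  θ.Sig.det ^ (-((n : ℝ) + a) / 2) *
    Real.exp ((-(1 / 2 : ℝ) • (θ.Sig⁻¹ * (D + (n : ℝ) • d.S θ))).trace -
      (1 / 2) * ((θ.alpha - m) ⬝ᵥ (C *ᵥ (θ.alpha - m))))

end VARX

end

/-! On Θ, likelihood times prior is a positive constant times f(α) |Σ|^{-(n+a)/2} etr(-Σ⁻¹(D +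
RᵀR)/2) with R = Y - Z𝒜 - Xℬ (`Data.likelihood_mul_prior`). This identity yields the density
formula, and it makes the evidence positive because the factor after f(α) is positive on Θ. The real
content is finiteness.

Least squares (`exists_leastSquares`) bounds tr(Σ⁻¹RᵀR) below by its minimum plus a multiple of
tr(Σ⁻¹(Γ - Γ₀)ᵀ(Γ - Γ₀)). Under condition 1, Y - Z𝒜 is regressed on X for each fixed α, and D ≥ δI
supplies a term δ tr Σ⁻¹. Under condition 2, Y is regressed on [Z, X], and D plus the minimal
residual cross product, positive definite by `posDef_residual`, supplies that term.

Each coefficient row integrated out as a Gaussian contributes |Σ|^{1/2}: p rows under condition 1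
(f(α) is then integrable by itself), p + qr rows under condition 2 (f(α) being replaced by its
bound). What remains is the integral of |Σ|^{-k/2} exp(-δ tr Σ⁻¹), with k = n + a - p or n + a - p -
qr. It is finite for k > 2r (`lintegral_invWishartKernel_lt_top`), by induction on r: after one row
and column are split off, the border is Gaussian given the Schur complement t, the t-integral is of
inverse gamma type, and together they leave a factor |W| of the remaining block W, which lowers k by
2. -/

namespace VARX

/-! ### Positive definite matrices -/

/-- In a continuous family of Hermitian matrices the positive definite ones form an open set. -/
theorem isOpen_setOf_posDef {T ι : Type*} [TopologicalSpace T] [Fintype ι]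
    {M : T → Matrix ι ι ℝ} (hM : Continuous M) (hH : ∀ t, (M t).IsHermitian) :
    IsOpen {t | (M t).PosDef} := by
  have hK : IsClosed {z : Metric.sphere (0 : ι → ℝ) 1 × T |
      (z.1 : ι → ℝ) ⬝ᵥ (M z.2 *ᵥ (z.1 : ι → ℝ)) ≤ 0} := by
    refine isClosed_le ?_ continuous_const
    have h1 : Continuous fun z : Metric.sphere (0 : ι → ℝ) 1 × T => (z.1 : ι → ℝ) := by fun_prop
    have h2 : Continuous fun z : Metric.sphere (0 : ι → ℝ) 1 × T => M z.2 := by fun_prop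
    exact h1.dotProduct (h2.matrix_mulVec h1)
  -- The parameters failing positivity are the projection of a closed set along the compact unit
  -- sphere, hence closed.
  have := (isClosedMap_snd_of_compactSpace (X := Metric.sphere (0 : ι → ℝ) 1) (Y := T) _ hK)
  convert! this.isOpen_compl using 1
  ext t
  simp only [Set.mem_ofPred_eq, Set.mem_compl_iff, Set.mem_image, Prod.exists, exists_eq_right,
    not_exists, not_le]
  constructor
  · intro h x
    refine h.dotProduct_mulVec_pos (x := (x : ι → ℝ)) ?_
    intro h0
    have := x.2
    simp [h0] at this
  · intro h
    refine Matrix.PosDef.of_dotProduct_mulVec_pos (hH t) fun x hx => ?_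
    have hn : 0 < ‖x‖ := norm_pos_iff.2 hx
    have := h ⟨‖x‖⁻¹ • x, by simp [norm_smul, hn.ne']⟩
    simp only [Matrix.mulVec_smul, smul_dotProduct, dotProduct_smul, smul_eq_mul] at this
    have h2 : 0 < ‖x‖⁻¹ := inv_pos.2 hn
    simpa using pos_of_mul_pos_right (pos_of_mul_pos_right this h2.le) h2.le

/-- A positive definite matrix dominates a positive multiple of the identity. -/
theorem exists_pos_sub_smul_one_posDef {ι : Type*} [Fintype ι] [DecidableEq ι]
    {M : Matrix ι ι ℝ} (hM : M.PosDef) : ∃ δ : ℝ, 0 < δ ∧ (M - δ • 1).PosDef := by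
  have h := isOpen_setOf_posDef (T := ℝ) (M := fun t => M - t • (1 : Matrix ι ι ℝ))
    (by fun_prop) (fun t => hM.isHermitian.sub (by
      simp [Matrix.IsHermitian]))
  have h0 : {t : ℝ | (M - t • (1 : Matrix ι ι ℝ)).PosDef} ∈ nhds (0 : ℝ) :=
    h.mem_nhds (by simpa using hM)
  obtain ⟨ε, hε, hb⟩ := Metric.mem_nhds_iff.1 h0
  exact ⟨ε / 2, by positivity, hb (by simp [abs_of_pos hε, hε])⟩

section

open scoped MatrixOrder

theorem PosDef.exists_eq_transpose_mul_self {ι : Type*} [Fintype ι] [DecidableEq ι]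
    {P : Matrix ι ι ℝ} (hP : P.PosDef) : ∃ L : Matrix ι ι ℝ, L.det ≠ 0 ∧ P = Lᵀ * L := by
  obtain ⟨L, hL, h⟩ := CStarAlgebra.isStrictlyPositive_iff_eq_star_mul_self.1 hP.isStrictlyPositive
  exact ⟨L, ((Matrix.isUnit_iff_isUnit_det L).1 hL).ne_zero, by
    simpa [Matrix.star_eq_conjTranspose] using h⟩

/-- With A = LᵀL the trace becomes that of L B Lᵀ, which is positive semidefinite. It turns every
Loewner inequality below into an inequality between exponents. -/
theorem PosSemidef.trace_mul_nonneg {ι : Type*} [Fintype ι] [DecidableEq ι]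
    {A B : Matrix ι ι ℝ} (hA : A.PosSemidef) (hB : B.PosSemidef) : 0 ≤ (A * B).trace := by
  obtain ⟨L, h⟩ := CStarAlgebra.nonneg_iff_eq_star_mul_self.1 hA.nonneg
  rw [h, Matrix.mul_assoc, Matrix.trace_mul_comm]
  exact (hB.mul_mul_conjTranspose_same L).trace_nonneg

end

theorem mul_trace_le_trace_mul {ι : Type*} [Fintype ι] [DecidableEq ι]
    {P D : Matrix ι ι ℝ} {δ : ℝ} (hP : P.PosSemidef) (hD : (D - δ • 1).PosSemidef) :
    δ * P.trace ≤ (P * D).trace := by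
  have := PosSemidef.trace_mul_nonneg hP hD
  rw [Matrix.mul_sub, Matrix.trace_sub, Matrix.mul_smul, Matrix.mul_one, Matrix.trace_smul,
    smul_eq_mul] at this
  linarith

/-! ### Least squares -/

/-- The weighted residual sum of squares exceeds its minimum by at least a multiple of the
squared distance of the coefficient from the least squares estimate. -/
theorem exists_leastSquares {ν κ ι : Type*} [Fintype ν] [Fintype κ] [DecidableEq κ]
    [Fintype ι] [DecidableEq ι] {H : Matrix ν κ ℝ} (hH : FullColumnRank H) :
    ∃ δ : ℝ, 0 < δ ∧ ∀ V : Matrix ν ι ℝ, ∃ Γ₀ : Matrix κ ι ℝ, ∀ P : Matrix ι ι ℝ,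
      P.PosSemidef → ∀ Γ : Matrix κ ι ℝ,
        (P * ((V - H * Γ₀)ᵀ * (V - H * Γ₀))).trace + δ * (P * ((Γ - Γ₀)ᵀ * (Γ - Γ₀))).trace ≤
          (P * ((V - H * Γ)ᵀ * (V - H * Γ))).trace := by
  have hG : (Hᵀ * H).PosDef := by
    simpa using Matrix.PosDef.conjTranspose_mul_self H (Matrix.mulVec_injective_iff.2 hH)
  -- δ depends on H alone. This uniformity in V matters when V = Y - Z𝒜 varies with α.
  obtain ⟨δ, hδ, hGδ⟩ := exists_pos_sub_smul_one_posDef hG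
  refine ⟨δ, hδ, fun V => ⟨(Hᵀ * H)⁻¹ * (Hᵀ * V), fun P hP Γ => ?_⟩⟩
  set Γ₀ := (Hᵀ * H)⁻¹ * (Hᵀ * V) with hΓ₀
  set R := V - H * Γ₀ with hR
  -- Normal equations: the residual is orthogonal to the columns of H, so the cross terms below
  -- vanish.
  have hHR : Hᵀ * R = 0 := by
    rw [hR, Matrix.mul_sub, hΓ₀, ← Matrix.mul_assoc, ← Matrix.mul_assoc,
      Matrix.mul_nonsing_inv _ ((Matrix.isUnit_iff_isUnit_det _).1 hG.isUnit), Matrix.one_mul,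
      sub_self]
  have hRH : Rᵀ * H = 0 := by
    rw [← Matrix.transpose_transpose (Rᵀ * H), Matrix.transpose_mul, Matrix.transpose_transpose,
      hHR, Matrix.transpose_zero]
  have hV : V - H * Γ = R - H * (Γ - Γ₀) := by rw [hR, Matrix.mul_sub]; abel
  have hexp : (V - H * Γ)ᵀ * (V - H * Γ) =
      Rᵀ * R + (Γ - Γ₀)ᵀ * (Hᵀ * H) * (Γ - Γ₀) := by
    rw [hV]
    generalize Γ - Γ₀ = Δ
    clear_value R
    have h1 : Rᵀ * (H * Δ) = 0 := by rw [← Matrix.mul_assoc, hRH, Matrix.zero_mul]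
    have h2 : Δᵀ * Hᵀ * R = 0 := by rw [Matrix.mul_assoc, hHR, Matrix.mul_zero]
    rw [Matrix.transpose_sub, Matrix.sub_mul, Matrix.mul_sub, Matrix.mul_sub,
      Matrix.transpose_mul, h1, h2]
    simp [Matrix.mul_assoc]
  have hpsd : ((Γ - Γ₀)ᵀ * (Hᵀ * H - δ • 1) * (Γ - Γ₀)).PosSemidef := by
    simpa using hGδ.posSemidef.conjTranspose_mul_mul_same (Γ - Γ₀)
  have := PosSemidef.trace_mul_nonneg hP hpsd
  rw [hexp, Matrix.mul_add, Matrix.trace_add]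
  generalize Γ - Γ₀ = Δ at this ⊢
  rw [Matrix.mul_sub, Matrix.sub_mul, Matrix.mul_sub, Matrix.trace_sub, Matrix.mul_smul,
    Matrix.mul_one, Matrix.smul_mul, Matrix.mul_smul, Matrix.trace_smul, smul_eq_mul] at this
  linarith

/-- The residual cross product is positive definite if response and regressors together have
linearly independent columns. -/
theorem posDef_residual {ν κ ι : Type*} [Fintype ν] [Fintype κ] [Fintype ι]
    {V : Matrix ν ι ℝ} {H : Matrix ν κ ℝ} (h : FullColumnRank (Matrix.fromCols V H))
    (Γ : Matrix κ ι ℝ) : ((V - H * Γ)ᵀ * (V - H * Γ)).PosDef := by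
  have hinj := Matrix.mulVec_injective_iff.2 h
  suffices Function.Injective (V - H * Γ).mulVec by
    simpa using Matrix.PosDef.conjTranspose_mul_self _ this
  intro x y hxy
  -- (V - HΓ)x is the combination of the columns of [V, H] with coefficients (x, -Γx), so
  -- injectivity passes from [V, H] to V - HΓ.
  have key : ∀ x, Matrix.fromCols V H *ᵥ Sum.elim x (-(Γ *ᵥ x)) = (V - H * Γ) *ᵥ x := by
    intro x
    rw [Matrix.fromCols_mulVec, Matrix.sub_mulVec]
    simp [Matrix.mulVec_neg, sub_eq_add_neg]
  have := hinj ((key x).trans (hxy.trans (key y).symm))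
  ext i
  simpa using congrFun this (Sum.inl i)

/-! ### Bordered matrices -/

/-- The matrix `[[W, v], [vᵀ, u]]`. -/
def bordered {ι : Type*} (W : Matrix ι ι ℝ) (v : ι → ℝ) (u : ℝ) :
    Matrix (ι ⊕ Unit) (ι ⊕ Unit) ℝ :=
  Matrix.fromBlocks W (Matrix.replicateCol Unit v) (Matrix.replicateRow Unit v)
    (Matrix.of fun _ _ => u)

theorem PosDef.of_bordered {ι : Type*} {W : Matrix ι ι ℝ} {v : ι → ℝ} {u : ℝ}
    (h : (bordered W v u).PosDef) : W.PosDef :=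
  h.submatrix (e := Sum.inl) Sum.inl_injective

theorem det_bordered {ι : Type*} [Fintype ι] [DecidableEq ι] {W : Matrix ι ι ℝ} {v : ι → ℝ}
    {u : ℝ} (hW : IsUnit W.det) :
    (bordered W v u).det = W.det * (u - v ⬝ᵥ (W⁻¹ *ᵥ v)) := by
  let _ := W.invertibleOfIsUnitDet hW
  rw [bordered, Matrix.det_fromBlocks₁₁]
  congr 1
  rw [Matrix.det_unique]
  simp [Matrix.mul_apply, dotProduct, Matrix.mulVec, Finset.sum_mul, Finset.mul_sum]
  rw [Finset.sum_comm]
  simp [mul_assoc]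

/-- The Schur complement t = u - vᵀW⁻¹v is positive because it is a ratio of two positive
determinants. With w = W⁻¹v, the inverse is diag(W⁻¹, 0) plus the rank-one matrix t⁻¹(w, -1)(w,
-1)ᵀ, which adds t⁻¹(|w|² + 1) to the trace. -/
theorem trace_inv_bordered {ι : Type*} [Fintype ι] [DecidableEq ι] {W : Matrix ι ι ℝ}
    {v : ι → ℝ} {u : ℝ} (h : (bordered W v u).PosDef) :
    0 < u - v ⬝ᵥ (W⁻¹ *ᵥ v) ∧
    (bordered W v u)⁻¹.trace = W⁻¹.trace +
      (u - v ⬝ᵥ (W⁻¹ *ᵥ v))⁻¹ * ((W⁻¹ *ᵥ v) ⬝ᵥ (W⁻¹ *ᵥ v)) + (u - v ⬝ᵥ (W⁻¹ *ᵥ v))⁻¹ := by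
  have hW := PosDef.of_bordered h
  have hWu : IsUnit W.det := (Matrix.isUnit_iff_isUnit_det _).1 hW.isUnit
  have hd := det_bordered (v := v) (u := u) hWu
  have ht : 0 < u - v ⬝ᵥ (W⁻¹ *ᵥ v) := by
    have := h.det_pos
    rw [hd] at this
    exact pos_of_mul_pos_right this hW.det_pos.le
  refine ⟨ht, ?_⟩
  set t := u - v ⬝ᵥ (W⁻¹ *ᵥ v) with htdef
  have hinv : (bordered W v u)⁻¹ = Matrix.fromBlocks
      (W⁻¹ + t⁻¹ • Matrix.vecMulVec (W⁻¹ *ᵥ v) (W⁻¹ *ᵥ v))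
      (Matrix.replicateCol Unit (-(t⁻¹ • (W⁻¹ *ᵥ v))))
      (Matrix.replicateRow Unit (-(t⁻¹ • (W⁻¹ *ᵥ v)))) (Matrix.of fun _ _ => t⁻¹) := by
    have hsymm : v ᵥ* W⁻¹ = W⁻¹ *ᵥ v := by
      rw [← Matrix.mulVec_transpose]
      congr 1
      simpa using hW.inv.isHermitian.eq
    have hWv : W *ᵥ (W⁻¹ *ᵥ v) = v := by
      rw [Matrix.mulVec_mulVec, Matrix.mul_nonsing_inv _ hWu, Matrix.one_mulVec]
    apply Matrix.inv_eq_right_inv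
    rw [bordered, Matrix.fromBlocks_multiply, ← Matrix.fromBlocks_one]
    set w := W⁻¹ *ᵥ v with hw
    congr 1
    · rw [Matrix.mul_add, Matrix.mul_nonsing_inv _ hWu, Matrix.mul_smul, Matrix.mul_vecMulVec, hWv]
      ext i j
      simp [Matrix.mul_apply, Matrix.vecMulVec_apply]
      ring
    · ext i j
      have := congrFun hWv i
      simp only [Matrix.mulVec, dotProduct] at this
      simp only [Matrix.mul_apply, Matrix.add_apply, Matrix.replicateCol_apply, Pi.neg_apply,
        Pi.smul_apply, smul_eq_mul, Matrix.of_apply, Finset.univ_unique, Finset.sum_singleton]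
      simp_rw [mul_neg, mul_left_comm _ t⁻¹]
      rw [Finset.sum_neg_distrib, ← Finset.mul_sum, this]
      simp
      ring
    · ext i j
      have h1 := congrFun hsymm j
      simp only [Matrix.vecMul, dotProduct] at h1
      simp only [Matrix.mul_add, Matrix.add_apply, Matrix.mul_smul, Matrix.smul_apply]
      simp only [Matrix.mul_apply, Matrix.replicateRow_apply, h1, Matrix.vecMulVec_apply,
        Matrix.of_apply, Finset.univ_unique, Finset.sum_singleton, Pi.neg_apply, Pi.smul_apply,
        smul_eq_mul, Matrix.zero_apply]
      simp_rw [← mul_assoc]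
      rw [← Finset.sum_mul]
      have h2 : ∑ x, v x * w x = u - t := by rw [htdef]; simp [dotProduct]
      rw [h2]
      field_simp
      ring
    · ext i j
      simp only [Matrix.mul_apply, Matrix.add_apply, Matrix.replicateRow_apply,
        Matrix.replicateCol_apply, Pi.neg_apply, Pi.smul_apply, smul_eq_mul, Matrix.of_apply,
        Finset.univ_unique, Finset.sum_singleton]
      simp_rw [mul_neg, mul_left_comm _ t⁻¹]
      rw [Finset.sum_neg_distrib, ← Finset.mul_sum]
      have h2 : ∑ x, v x * w x = u - t := by rw [htdef]; simp [dotProduct]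
      rw [h2]
      simp
      field_simp
      ring
  rw [hinv]
  simp [Matrix.trace, Matrix.vecMulVec_apply, Finset.sum_add_distrib, dotProduct, Finset.mul_sum]

end VARX

namespace VARX

/-! ### Gaussian integrals -/

theorem lintegral_comp_linearMap {E : Type*} [NormedAddCommGroup E] [NormedSpace ℝ E]
    [MeasurableSpace E] [BorelSpace E] [FiniteDimensional ℝ E] (μ : Measure E)
    [μ.IsAddHaarMeasure] {f : E →ₗ[ℝ] E} (hf : LinearMap.det f ≠ 0) {F : E → ℝ≥0∞}
    (hF : Measurable F) :
    ∫⁻ x, F (f x) ∂μ = ENNReal.ofReal |(LinearMap.det f)⁻¹| * ∫⁻ x, F x ∂μ := by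
  have hm : Measurable f := f.continuous_of_finiteDimensional.measurable
  rw [← lintegral_map hF hm, Measure.map_linearMap_addHaar_eq_smul_addHaar μ hf,
    lintegral_smul_measure, smul_eq_mul]

/-- A linear coordinate change multiplies integrals by a finite constant. -/
theorem exists_lintegral_comp_equiv {E F : Type*}
    [AddCommGroup E] [Module ℝ E] [TopologicalSpace E] [IsTopologicalAddGroup E]
    [ContinuousSMul ℝ E] [T2Space E] [FiniteDimensional ℝ E] [MeasurableSpace E] [BorelSpace E]
    (μ : Measure E) [μ.IsAddHaarMeasure]
    [AddCommGroup F] [Module ℝ F] [TopologicalSpace F] [IsTopologicalAddGroup F]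
    [ContinuousSMul ℝ F] [T2Space F] [LocallyCompactSpace F] [SecondCountableTopology F]
    [MeasurableSpace F] [BorelSpace F] (ν : Measure F) [ν.IsAddHaarMeasure] (e : E ≃ₗ[ℝ] F) :
    ∃ c : ℝ≥0∞, c ≠ ∞ ∧ ∀ g : F → ℝ≥0∞, ∫⁻ x, g (e x) ∂μ = c * ∫⁻ y, g y ∂ν := by
  let e' := e.toContinuousLinearEquiv
  have : (μ.map e').IsAddHaarMeasure := e'.isAddHaarMeasure_map μ
  -- Uniqueness of Haar measure: the pushforward is a finite multiple of ν.
  refine ⟨((μ.map e').addHaarScalarFactor ν : NNReal), ENNReal.coe_ne_top, fun g => ?_⟩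
  have h : ∫⁻ x, g (e x) ∂μ = ∫⁻ y, g y ∂(μ.map e') :=
    (e'.toHomeomorph.measurableEmbedding.lintegral_map g).symm
  rw [h]
  conv_lhs => rw [Measure.isAddLeftInvariant_eq_smul (μ.map e') ν]
  exact lintegral_smul_measure _ _

theorem lintegral_exp_neg_sq_lt_top {κ ι : Type*} [Fintype κ] [Fintype ι] {c : ℝ} (hc : 0 < c) :
    ∫⁻ x : κ → ι → ℝ, ENNReal.ofReal (Real.exp (-c * ∑ k, ∑ i, x k i ^ 2)) < ∞ := by
  have h : Integrable (fun x : κ → ι → ℝ => ∏ k, ∏ i, Real.exp (-c * x k i ^ 2)) := by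
    refine Integrable.fintype_prod (f := fun _ (y : ι → ℝ) => ∏ i, Real.exp (-c * y i ^ 2)) ?_
    intro _
    exact Integrable.fintype_prod (f := fun _ (z : ℝ) => Real.exp (-c * z ^ 2))
      fun _ => integrable_exp_neg_mul_sq hc
  simp_rw [Finset.mul_sum, Real.exp_sum]
  exact h.lintegral_lt_top

/-- The matrix normal integral, up to a constant. -/
theorem exists_lintegral_matrixNormal {E : Type*} [NormedAddCommGroup E] [NormedSpace ℝ E]
    [MeasurableSpace E] [BorelSpace E] [FiniteDimensional ℝ E] (μ : Measure E)
    [μ.IsAddHaarMeasure] {κ ι : Type*} [Fintype κ] [Fintype ι] [DecidableEq ι]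
    (e : E ≃ₗ[ℝ] (κ → ι → ℝ)) {c : ℝ} (hc : 0 < c) :
    ∃ K : ℝ≥0∞, K ≠ ∞ ∧ ∀ L : Matrix ι ι ℝ, L.det ≠ 0 → ∀ M₀ : Matrix κ ι ℝ,
      ∫⁻ x, ENNReal.ofReal (Real.exp (-c *
        ((Lᵀ * L) * ((Matrix.of (e x) - M₀)ᵀ * (Matrix.of (e x) - M₀))).trace)) ∂μ =
      K * ENNReal.ofReal (|L.det|⁻¹ ^ Fintype.card κ) := by
  obtain ⟨c₁, hc₁, he⟩ := exists_lintegral_comp_equiv μ (volume : Measure (κ → ι → ℝ)) e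
  refine ⟨c₁ * ∫⁻ x : κ → ι → ℝ, ENNReal.ofReal (Real.exp (-c * ∑ k, ∑ i, x k i ^ 2)),
    ENNReal.mul_ne_top hc₁ (lintegral_exp_neg_sq_lt_top hc).ne, fun L hL M₀ => ?_⟩
  -- Applying L to every row turns the quadratic form into a plain sum of squares; the determinant
  -- is a product of one det L per row.
  let f : (κ → ι → ℝ) →ₗ[ℝ] (κ → ι → ℝ) :=
    LinearMap.pi fun k => (Matrix.toLin' L) ∘ₗ LinearMap.proj k
  have hdet : LinearMap.det f = L.det ^ Fintype.card κ := by
    rw [LinearMap.det_pi]; simp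
  have htr : ∀ y : κ → ι → ℝ, ((Lᵀ * L) * ((Matrix.of y)ᵀ * (Matrix.of y))).trace =
      ∑ k, ∑ i, f y k i ^ 2 := by
    intro y
    have : ((Lᵀ * L) * ((Matrix.of y)ᵀ * (Matrix.of y))).trace =
        ((Matrix.of y * Lᵀ) * (Matrix.of y * Lᵀ)ᵀ).trace := by
      rw [Matrix.transpose_mul, Matrix.transpose_transpose, Matrix.trace_mul_comm,
        Matrix.mul_assoc, Matrix.trace_mul_comm]
      simp only [Matrix.mul_assoc]
    rw [this]
    simp only [Matrix.trace, Matrix.diag, Matrix.mul_apply, Matrix.transpose_apply, f,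
      LinearMap.pi_apply, LinearMap.comp_apply, LinearMap.proj_apply, Matrix.toLin'_apply,
      Matrix.mulVec, dotProduct, Matrix.of_apply, sq]
    simp only [mul_comm (L _ _)]
  have h1 : ∀ y : κ → ι → ℝ, Matrix.of y - M₀ = Matrix.of (y - Matrix.of.symm M₀) := fun y => rfl
  rw [he (fun y => ENNReal.ofReal (Real.exp (-c *
        ((Lᵀ * L) * ((Matrix.of y - M₀)ᵀ * (Matrix.of y - M₀))).trace)))]
  simp_rw [h1, htr]
  rw [lintegral_sub_right_eq_self (fun y => ENNReal.ofReal (Real.exp (-c *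
        ∑ k, ∑ i, f y k i ^ 2))) (Matrix.of.symm M₀),
    lintegral_comp_linearMap volume (f := f) (F := fun y => ENNReal.ofReal (Real.exp (-c *
        ∑ k, ∑ i, y k i ^ 2))) (by rw [hdet]; exact pow_ne_zero _ hL) (by fun_prop), hdet,
    abs_inv, abs_pow, ← inv_pow]
  ring

/-! ### The inverse gamma integral -/

/-- The substitution y = t⁻¹ gives a gamma integral; the Jacobian t⁻² accounts for the exponent b -
2, and b > 1 is convergence at y = 0. -/
theorem lintegral_inverseGamma_lt_top {b c : ℝ} (hb : 1 < b) (hc : 0 < c) :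
    ∫⁻ t in Set.Ioi (0 : ℝ), ENNReal.ofReal (t ^ (-b) * Real.exp (-c * t⁻¹)) < ∞ := by
  have h1 : IntegrableOn (fun y : ℝ => y ^ (b - 2) * Real.exp (-c * y ^ (1 : ℝ)))
      (Set.Ioi 0) := integrableOn_rpow_mul_exp_neg_mul_rpow (by linarith) one_pos hc
  have h2 := (integrableOn_Ioi_comp_rpow_iff _ (p := (-1 : ℝ)) (by norm_num)).2 h1
  refine IntegrableOn.setLIntegral_lt_top (h2.congr_fun ?_ measurableSet_Ioi)
  intro t (ht : 0 < t)
  simp only [abs_neg, abs_one, one_mul, smul_eq_mul, Real.rpow_one]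
  rw [← Real.rpow_mul ht.le, ← mul_assoc, ← Real.rpow_add ht, Real.rpow_neg_one]
  congr 2
  ring

/-- This half of Tonelli needs no measurability of f, and upper bounds are all that finiteness
requires. -/
theorem lintegral_prod_symm_le {α β : Type*} [MeasurableSpace α] [MeasurableSpace β]
    {μ : Measure α} {ν : Measure β} [SFinite μ] [SFinite ν] (f : α × β → ℝ≥0∞) :
    ∫⁻ z, f z ∂μ.prod ν ≤ ∫⁻ y, ∫⁻ x, f (x, y) ∂μ ∂ν := by
  rw [← (Measure.measurePreserving_swap (μ := ν) (ν := μ)).lintegral_comp_emb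
    MeasurableEquiv.prodComm.measurableEmbedding f]
  exact lintegral_prod_le _
end VARX

noncomputable section
namespace VARX

/-! ### The inverse Wishart integral -/

/-- The entries on and above the diagonal of a matrix with first row and column split off. -/
def upperIdxSucc (r : ℕ) : UpperIdx r ⊕ (Fin r ⊕ Unit) → UpperIdx (r + 1)
  | Sum.inl ij => ⟨(ij.1.1.succ, ij.1.2.succ), Fin.succ_le_succ_iff.2 ij.2⟩
  | Sum.inr (Sum.inl j) => ⟨(0, j.succ), Fin.zero_le _⟩
  | Sum.inr (Sum.inr _) => ⟨(0, 0), le_rfl⟩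

theorem upperIdxSucc_bijective (r : ℕ) : Function.Bijective (upperIdxSucc r) := by
  constructor
  · rintro (⟨⟨i, j⟩, h⟩ | j | _) (⟨⟨i', j'⟩, h'⟩ | j' | _) hh <;>
      simp_all [upperIdxSucc, Fin.succ_ne_zero, (Fin.succ_ne_zero _).symm]
  · rintro ⟨⟨i, j⟩, h⟩
    rcases Fin.eq_zero_or_eq_succ i with rfl | ⟨i', rfl⟩
    · rcases Fin.eq_zero_or_eq_succ j with rfl | ⟨j', rfl⟩
      · exact ⟨Sum.inr (Sum.inr ()), rfl⟩
      · exact ⟨Sum.inr (Sum.inl j'), rfl⟩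
    · rcases Fin.eq_zero_or_eq_succ j with rfl | ⟨j', rfl⟩
      · exact absurd h (by simp)
      · exact ⟨Sum.inl ⟨(i', j'), Fin.succ_le_succ_iff.1 h⟩, rfl⟩

/-- Splitting off the first row and column of a symmetric matrix. -/
def upperSplit (r : ℕ) :
    (UpperIdx (r + 1) → ℝ) ≃ₗ[ℝ] (UpperIdx r → ℝ) × (Fin r → ℝ) × ℝ :=
  (LinearEquiv.funCongrLeft ℝ ℝ (Equiv.ofBijective _ (upperIdxSucc_bijective r))).trans
    ((LinearEquiv.sumArrowLequivProdArrow _ _ ℝ ℝ).trans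
      ((LinearEquiv.refl ℝ _).prodCongr
        ((LinearEquiv.sumArrowLequivProdArrow _ _ ℝ ℝ).trans
          ((LinearEquiv.refl ℝ _).prodCongr (LinearEquiv.funUnique Unit ℝ ℝ)))))

/-- The reindexing sends 0 to the `Unit` slot and `i.succ` to `Sum.inl i`, so the first row and
column become the border, placed last. -/
theorem symmetricMatrix_eq_bordered {r : ℕ} (s : UpperIdx (r + 1) → ℝ) :
    symmetricMatrix s =
      (bordered (symmetricMatrix (upperSplit r s).1) (upperSplit r s).2.1
        (upperSplit r s).2.2).submatrix
        ((finSuccEquiv r).trans (Equiv.optionEquivSumPUnit _))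
        ((finSuccEquiv r).trans (Equiv.optionEquivSumPUnit _)) := by
  ext i j
  rcases Fin.eq_zero_or_eq_succ i with rfl | ⟨i, rfl⟩ <;>
  rcases Fin.eq_zero_or_eq_succ j with rfl | ⟨j, rfl⟩
  · rfl
  · simp [bordered]
    rfl
  · simp [bordered]
    rfl
  · simp [bordered, symmetricMatrix, upperSplit, upperIdxSucc, LinearEquiv.funCongrLeft]
    congr 1
    simp [Fin.ext_iff, Fin.coe_min, Fin.coe_max]

/-- The kernel `|V|^{-k/2} exp(-δ tr V⁻¹)` of an inverse Wishart density. -/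
def invWishartKernel {ι : Type*} [Fintype ι] [DecidableEq ι] (k δ : ℝ) (V : Matrix ι ι ℝ) :
    ℝ≥0∞ :=
  ENNReal.ofReal (V.det ^ (-k / 2) * Real.exp (-δ * V⁻¹.trace))

theorem measurableSet_posDef (r : ℕ) :
    MeasurableSet {s : UpperIdx r → ℝ | (symmetricMatrix s).PosDef} := by
  refine (isOpen_setOf_posDef (M := fun s => symmetricMatrix s) ?_ ?_).measurableSet
  · exact continuous_matrix fun i j => continuous_apply _
  · intro s
    ext i j
    simp [symmetricMatrix, min_comm, max_comm]

theorem invWishartKernel_bordered {ι : Type*} [Fintype ι] [DecidableEq ι] {W : Matrix ι ι ℝ}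
    {v : ι → ℝ} {u : ℝ} (h : (bordered W v u).PosDef) (k δ : ℝ) :
    invWishartKernel k δ (bordered W v u) = invWishartKernel k δ W *
      (Set.Ioi (0 : ℝ)).indicator (fun t => ENNReal.ofReal (t ^ (-k / 2) * Real.exp (-δ * t⁻¹)) *
        ENNReal.ofReal (Real.exp (-δ * (t⁻¹ * ((W⁻¹ *ᵥ v) ⬝ᵥ (W⁻¹ *ᵥ v))))))
        (u - v ⬝ᵥ (W⁻¹ *ᵥ v)) := by
  obtain ⟨ht, htr⟩ := trace_inv_bordered h
  have hW := PosDef.of_bordered h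
  rw [Set.indicator_of_mem (by exact ht), invWishartKernel, invWishartKernel, htr,
    det_bordered ((Matrix.isUnit_iff_isUnit_det _).1 hW.isUnit)]
  generalize u - v ⬝ᵥ (W⁻¹ *ᵥ v) = t at ht
  have hd := hW.det_pos
  rw [Real.mul_rpow hd.le ht.le, ← ENNReal.ofReal_mul (by positivity),
    ← ENNReal.ofReal_mul (by positivity)]
  congr 1
  rw [mul_add, mul_add, Real.exp_add, Real.exp_add]
  ring

/-- The integral of a bordered inverse Wishart kernel over the last column. -/
theorem exists_lintegral_border_le (r : ℕ) {k δ : ℝ} (hk : (r : ℝ) + 2 < k) (hδ : 0 < δ) :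
    ∃ K : ℝ≥0∞, K ≠ ∞ ∧ ∀ W : Matrix (Fin r) (Fin r) ℝ, W.PosDef →
      ∫⁻ v : Fin r → ℝ, ∫⁻ u : ℝ,
        (Set.Ioi (0 : ℝ)).indicator (fun t => ENNReal.ofReal (t ^ (-k / 2) * Real.exp (-δ * t⁻¹)) *
        ENNReal.ofReal (Real.exp (-δ * (t⁻¹ * ((W⁻¹ *ᵥ v) ⬝ᵥ (W⁻¹ *ᵥ v))))))
        (u - v ⬝ᵥ (W⁻¹ *ᵥ v)) ≤ K * ENNReal.ofReal W.det := by
  obtain ⟨K, hK, hKe⟩ := exists_lintegral_matrixNormal (volume : Measure (Fin r → ℝ))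
    (LinearEquiv.funUnique Unit ℝ (Fin r → ℝ)).symm hδ
  -- Integrating out v gives t^{r/2}, whence the exponent (k - r)/2; it exceeds 1 exactly when k > r
  -- + 2.
  refine ⟨K * ∫⁻ t in Set.Ioi (0 : ℝ), ENNReal.ofReal
    (t ^ (-((k - r) / 2)) * Real.exp (-δ * t⁻¹)),
    ENNReal.mul_ne_top hK (lintegral_inverseGamma_lt_top (by linarith) hδ).ne, fun W hW => ?_⟩
  have hd := hW.det_pos
  set G : (Fin r → ℝ) → ℝ → ℝ≥0∞ := fun v => (Set.Ioi (0 : ℝ)).indicator fun t =>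
    ENNReal.ofReal (t ^ (-k / 2) * Real.exp (-δ * t⁻¹)) *
        ENNReal.ofReal (Real.exp (-δ * (t⁻¹ * ((W⁻¹ *ᵥ v) ⬝ᵥ (W⁻¹ *ᵥ v))))) with hG
  -- For fixed v, translation replaces u by the Schur complement t; the order of integration is then
  -- swapped so that v is integrated at fixed t.
  have h1 : ∀ v, ∫⁻ u : ℝ, G v (u - v ⬝ᵥ (W⁻¹ *ᵥ v)) = ∫⁻ t, G v t := fun v =>
    lintegral_sub_right_eq_self (G v) _
  have hmeas : Measurable (Function.uncurry G) := by
    have : Function.uncurry G = (Set.univ ×ˢ Set.Ioi (0 : ℝ)).indicator fun z =>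
        ENNReal.ofReal (z.2 ^ (-k / 2) * Real.exp (-δ * z.2⁻¹)) *
        ENNReal.ofReal (Real.exp (-δ * (z.2⁻¹ * ((W⁻¹ *ᵥ z.1) ⬝ᵥ (W⁻¹ *ᵥ z.1))))) := by
      ext ⟨v, t⟩
      simp [Function.uncurry, G, Set.indicator]
    rw [this]
    refine Measurable.indicator ?_ (MeasurableSet.univ.prod measurableSet_Ioi)
    have hc : Measurable fun v : Fin r → ℝ => (W⁻¹ *ᵥ v) ⬝ᵥ (W⁻¹ *ᵥ v) := by
      refine Continuous.measurable ?_
      have : Continuous fun v : Fin r → ℝ => W⁻¹ *ᵥ v := continuous_const.matrix_mulVec continuous_id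
      exact this.dotProduct this
    have := hc.comp (measurable_fst : Measurable (Prod.fst : (Fin r → ℝ) × ℝ → _))
    simp only [Function.comp_def] at this
    fun_prop
  change ∫⁻ v, ∫⁻ u : ℝ, G v (u - v ⬝ᵥ (W⁻¹ *ᵥ v)) ≤ _
  simp_rw [h1]
  rw [lintegral_lintegral_swap hmeas.aemeasurable]
  have h2 : ∀ t, ∫⁻ v, G v t ≤ (Set.Ioi (0 : ℝ)).indicator (fun t => K * ENNReal.ofReal W.det *
      ENNReal.ofReal (t ^ (-((k - r) / 2)) * Real.exp (-δ * t⁻¹))) t := by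
    intro t
    by_cases ht : 0 < t
    swap
    · simp [G, ht]
    -- The matrix L = t^{-1/2}W⁻¹ makes the form in v equal to |Lv|², and |det L|⁻¹ = t^{r/2} det W.
    have hL : ((Real.sqrt t)⁻¹ • W⁻¹).det ≠ 0 := by
      rw [Matrix.det_smul, Matrix.det_nonsing_inv]
      have := Real.sqrt_pos.2 ht
      simp only [Ring.inverse_eq_inv']
      positivity
    have htr : ∀ v : Fin r → ℝ, t⁻¹ * ((W⁻¹ *ᵥ v) ⬝ᵥ (W⁻¹ *ᵥ v)) =
        ((((Real.sqrt t)⁻¹ • W⁻¹)ᵀ * ((Real.sqrt t)⁻¹ • W⁻¹)) *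
          ((Matrix.of ((LinearEquiv.funUnique Unit ℝ (Fin r → ℝ)).symm v) - 0)ᵀ *
            (Matrix.of ((LinearEquiv.funUnique Unit ℝ (Fin r → ℝ)).symm v) - 0))).trace := by
      intro v
      have hof : Matrix.of ((LinearEquiv.funUnique Unit ℝ (Fin r → ℝ)).symm v) =
        Matrix.replicateRow Unit v := rfl
      rw [sub_zero, hof, Matrix.transpose_replicateRow, ← Matrix.vecMulVec_eq,
        Matrix.mul_vecMulVec, Matrix.trace_vecMulVec, ← Matrix.mulVec_mulVec,
        Matrix.mulVec_transpose, ← Matrix.dotProduct_mulVec, Matrix.smul_mulVec, smul_dotProduct,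
        dotProduct_smul, smul_smul, ← mul_inv, Real.mul_self_sqrt ht.le, smul_eq_mul]
    rw [Set.indicator_of_mem (by exact ht)]
    simp only [G, Set.indicator_of_mem (show t ∈ Set.Ioi (0 : ℝ) from ht)]
    rw [lintegral_const_mul' _ _ ENNReal.ofReal_ne_top]
    simp_rw [htr]
    rw [hKe _ hL 0, Fintype.card_unit, pow_one, mul_left_comm, mul_assoc K]
    refine le_of_eq ?_
    congr 1
    rw [← ENNReal.ofReal_mul (by positivity), ← ENNReal.ofReal_mul (by positivity)]
    congr 1
    rw [Matrix.det_smul, Matrix.det_nonsing_inv, Ring.inverse_eq_inv', Fintype.card_fin,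
      abs_of_pos (by have := Real.sqrt_pos.2 ht; positivity), mul_inv, inv_inv, inv_pow, inv_inv,
      Real.sqrt_eq_rpow, ← Real.rpow_natCast, ← Real.rpow_mul ht.le,
      show -((k - r) / 2) = -k / 2 + 1 / 2 * r by ring, Real.rpow_add ht]
    ring
  calc ∫⁻ t, ∫⁻ v, G v t ≤ _ := lintegral_mono h2
    _ = _ := by
      rw [lintegral_indicator measurableSet_Ioi, lintegral_const_mul' _ _ (by finiteness)]
      ring

theorem lintegral_invWishartKernel_lt_top (r : ℕ) : ∀ {k δ : ℝ}, 2 * (r : ℝ) < k → 0 < δ →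
    ∫⁻ s in {s : UpperIdx r → ℝ | (symmetricMatrix s).PosDef},
      invWishartKernel k δ (symmetricMatrix s) < ∞ := by
  induction r with
  | zero =>
    intro k δ _ _
    calc _ ≤ ∫⁻ s : UpperIdx 0 → ℝ, 1 := by
            refine (setLIntegral_le_lintegral _ _).trans (lintegral_mono fun s => ?_)
            simp [invWishartKernel, Matrix.trace]
      _ < ∞ := by
        rw [lintegral_one, volume_pi, Measure.pi_univ]
        simp
  | succ r ih =>
    intro k δ hk hδ
    push_cast at hk
    have hr : (0 : ℝ) ≤ r := r.cast_nonneg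
    have hHaar : ((volume : Measure (UpperIdx r → ℝ)).prod
        ((volume : Measure (Fin r → ℝ)).prod (volume : Measure ℝ))).IsAddHaarMeasure := by
      refine @Measure.prod.instIsAddHaarMeasure _ _ _ _ _ _ _ _ _ _ ?_ ?_ ?_ ?_ ?_ ?_ <;>
      infer_instance
    obtain ⟨c, hc, he⟩ := exists_lintegral_comp_equiv (volume : Measure (UpperIdx (r + 1) → ℝ))
      ((volume : Measure (UpperIdx r → ℝ)).prod
        ((volume : Measure (Fin r → ℝ)).prod (volume : Measure ℝ))) (upperSplit r)
    obtain ⟨K, hK, hKe⟩ := exists_lintegral_border_le r (k := k) (by linarith) hδ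
    set f := (finSuccEquiv r).trans (Equiv.optionEquivSumPUnit _) with hf
    -- The border integral contributes det W = (det W)^{2/2}, so the block W carries the parameter k
    -- - 2, and k > 2(r + 1) becomes k - 2 > 2r.
    have hfin := ih (k := k - 2) (δ := δ) (by linarith) hδ
    set G : Matrix (Fin r) (Fin r) ℝ → (Fin r → ℝ) → ℝ → ℝ≥0∞ := fun W v u =>
      (Set.Ioi (0 : ℝ)).indicator (fun t => ENNReal.ofReal (t ^ (-k / 2) * Real.exp (-δ * t⁻¹)) *
        ENNReal.ofReal (Real.exp (-δ * (t⁻¹ * ((W⁻¹ *ᵥ v) ⬝ᵥ (W⁻¹ *ᵥ v))))))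
        (u - v ⬝ᵥ (W⁻¹ *ᵥ v)) with hG
    set H : (UpperIdx r → ℝ) × (Fin r → ℝ) × ℝ → ℝ≥0∞ := fun z =>
      {s : UpperIdx r → ℝ | (symmetricMatrix s).PosDef}.indicator (fun s =>
        invWishartKernel k δ (symmetricMatrix s) * G (symmetricMatrix s) z.2.1 z.2.2) z.1 with hH
    rw [← lintegral_indicator (measurableSet_posDef _)]
    calc _ ≤ ∫⁻ s, H (upperSplit r s) := by
          refine lintegral_mono fun s => ?_
          by_cases hs : (symmetricMatrix s).PosDef
          swap
          · simp [hs]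
          rw [Set.indicator_of_mem (by exact hs)]
          rw [symmetricMatrix_eq_bordered] at hs
          have hs' : (bordered (symmetricMatrix (upperSplit r s).1) (upperSplit r s).2.1
              (upperSplit r s).2.2).PosDef := by
            have := hs.submatrix f.symm.injective
            rwa [Matrix.submatrix_submatrix, ← hf, f.self_comp_symm,
              Matrix.submatrix_id_id] at this
          rw [hH]
          simp only
          rw [Set.indicator_of_mem (by exact PosDef.of_bordered hs'), hG,
            ← invWishartKernel_bordered hs', symmetricMatrix_eq_bordered]
          simp only [invWishartKernel, Matrix.det_submatrix_equiv_self, Matrix.inv_submatrix_equiv]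
          rw [show ∀ M : Matrix (Fin r ⊕ Unit) (Fin r ⊕ Unit) ℝ,
            (M.submatrix f f).trace = M.trace from fun M => Equiv.sum_comp f fun i => M i i]
      _ = c * ∫⁻ z, H z ∂(volume.prod (volume.prod volume)) := he H
      _ ≤ c * ∫⁻ w in {s : UpperIdx r → ℝ | (symmetricMatrix s).PosDef},
            K * invWishartKernel (k - 2) δ (symmetricMatrix w) := by
          gcongr
          rw [← lintegral_indicator (measurableSet_posDef _)]
          refine (lintegral_prod_le _).trans (lintegral_mono fun w => ?_)
          by_cases hw : (symmetricMatrix w).PosDef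
          swap
          · simp [hH, hw]
          simp only [hH, Set.mem_ofPred_eq, hw, Set.indicator_of_mem]
          refine (lintegral_prod_le _).trans ?_
          simp only
          have hinv : invWishartKernel k δ (symmetricMatrix w) ≠ ∞ := ENNReal.ofReal_ne_top
          simp_rw [lintegral_const_mul' _ _ hinv]
          refine (mul_le_mul_right (hKe _ hw) _).trans (le_of_eq ?_)
          rw [mul_left_comm]
          congr 1
          have hd := hw.det_pos
          rw [invWishartKernel, invWishartKernel, ← ENNReal.ofReal_mul (by positivity),
            show -(k - 2) / 2 = -k / 2 + 1 by ring, Real.rpow_add hd, Real.rpow_one]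
          congr 1
          ring
      _ < ∞ := by
          rw [lintegral_const_mul' _ _ hK]
          exact ENNReal.mul_lt_top hc.lt_top (ENNReal.mul_lt_top hK.lt_top hfin)

end VARX
end

noncomputable section
namespace VARX

variable {n q r p : ℕ}

/-! ### The unnormalized posterior density -/

/-- The `n × r` matrix `Y - Z𝒜 - Xℬ` of innovations. -/
def Data.resid (d : Data n q r p) (θ : Param q r p) : Matrix (Fin n) (Fin r) ℝ :=
  d.Y - d.Z * θ.calA - d.X * θ.calB

/-- For n = 0 the inverse of n is 0 by convention, but the residual matrix has no rows and both
sides vanish. -/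
theorem Data.natCast_smul_S (d : Data n q r p) (θ : Param q r p) :
    (n : ℝ) • d.S θ = (d.resid θ)ᵀ * d.resid θ := by
  rcases Nat.eq_zero_or_pos n with rfl | hn
  · ext i j
    simp [Matrix.mul_apply]
  · have : (n : ℝ) ≠ 0 := by positivity
    rw [Data.S, smul_smul, mul_inv_cancel₀ this, one_smul, Data.resid]

theorem Data.innovation_eq_resid (d : Data n q r p) (θ : Param q r p) (t : Fin n) :
    d.innovation θ t = d.resid θ t := by
  ext k
  simp only [Data.innovation, Data.resid, Pi.sub_apply, Matrix.sub_apply, Finset.sum_apply,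
    Matrix.mulVec, dotProduct, Matrix.mul_apply, Matrix.transpose_apply, Data.Z, Matrix.of_apply,
    Fintype.sum_prod_type, Param.lagCoef, mul_comm]

theorem trace_mul_transpose_mul_self {ν ι : Type*} [Fintype ν] [Fintype ι] (P : Matrix ι ι ℝ)
    (E : Matrix ν ι ℝ) : (P * (Eᵀ * E)).trace = ∑ t, E t ⬝ᵥ (P *ᵥ E t) := by
  rw [← Matrix.mul_assoc, Matrix.trace_mul_comm, Matrix.trace]
  refine Finset.sum_congr rfl fun t _ => ?_
  simp [Matrix.mul_apply, dotProduct, Matrix.mulVec]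

theorem Data.condDensity_eq (d : Data n q r p) {θ : Param q r p} (hθ : θ ∈ Theta q r p) :
    d.condDensity θ = ((2 * Real.pi) ^ (-(r : ℝ) / 2)) ^ n * θ.Sig.det ^ (-(n : ℝ) / 2) *
      Real.exp (-(1 / 2) * (θ.Sig⁻¹ * ((d.resid θ)ᵀ * d.resid θ)).trace) := by
  have hd : 0 < θ.Sig.det := Matrix.PosDef.det_pos hθ
  simp only [Data.condDensity, normalDensity, Data.innovation_eq_resid]
  rw [Finset.prod_mul_distrib, Finset.prod_const, ← Real.exp_sum, mul_pow, Finset.card_univ,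
    Fintype.card_fin, ← Real.rpow_mul_natCast hd.le, trace_mul_transpose_mul_self, Finset.mul_sum]
  congr 2
  · congr 1
    ring
  · refine Finset.sum_congr rfl fun t _ => ?_
    ring

/-- The kernel `|Σ|^{-(n+a)/2} etr(-Σ⁻¹[D + nS]/2)`. -/
def Data.wishartKernel (d : Data n q r p) (a : ℝ) (D : Matrix (Fin r) (Fin r) ℝ)
    (θ : Param q r p) : ℝ :=
  θ.Sig.det ^ (-((n : ℝ) + a) / 2) *
    Real.exp (-(1 / 2) * (θ.Sig⁻¹ * (D + (d.resid θ)ᵀ * d.resid θ)).trace)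

theorem Data.likelihood_mul_prior (d : Data n q r p)
    {fX : Matrix (Fin n) (Fin p) ℝ → ℝ} (hfX : 0 < fX d.X)
    {a : ℝ} {D : Matrix (Fin r) (Fin r) ℝ} (fα : (AlphaIdx q r → ℝ) → ℝ)
    {fB : Matrix (Fin p) (Fin r) ℝ → ℝ} (hfB : ProportionalOn Set.univ fB (fun _ => 1))
    {fS : Matrix (Fin r) (Fin r) ℝ → ℝ}
    (hfS : ProportionalOn {V | V.PosDef} fS (covPriorKernel a D)) :
    ∃ c : ℝ, 0 < c ∧ ∀ θ ∈ Theta q r p, d.likelihood fX θ * priorDensity fα fB fS θ =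
      c * (fα θ.alpha * d.wishartKernel a D θ) := by
  obtain ⟨cB, hcB, hB⟩ := hfB
  obtain ⟨cS, hcS, hS⟩ := hfS
  refine ⟨fX d.X * ((2 * Real.pi) ^ (-(r : ℝ) / 2)) ^ n * cB * cS, by positivity,
    fun θ hθ => ?_⟩
  have hd : 0 < θ.Sig.det := Matrix.PosDef.det_pos hθ
  rw [Data.likelihood, d.condDensity_eq hθ, priorDensity, hB _ (Set.mem_univ _), hS _ hθ,
    covPriorKernel, etr, Data.wishartKernel, Matrix.mul_add, Matrix.trace_add, mul_add,
    Real.exp_add, Matrix.trace_smul, smul_eq_mul, Matrix.trace_mul_comm D,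
    show -((n : ℝ) + a) / 2 = -(n : ℝ) / 2 + -a / 2 by ring, Real.rpow_add hd]
  ring

theorem Data.posteriorKernel_eq (d : Data n q r p) (a : ℝ) (D : Matrix (Fin r) (Fin r) ℝ)
    (m : AlphaIdx q r → ℝ) (C : Matrix (AlphaIdx q r) (AlphaIdx q r) ℝ) (θ : Param q r p) :
    d.posteriorKernel a D m C θ = normalPriorKernel m C θ.alpha * d.wishartKernel a D θ := by
  rw [Data.posteriorKernel, normalPriorKernel, Data.wishartKernel, d.natCast_smul_S,
    sub_eq_add_neg, Real.exp_add, Matrix.trace_smul, smul_eq_mul]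
  rw [show -((θ.alpha - m) ⬝ᵥ (C *ᵥ (θ.alpha - m))) / 2 =
    -(1 / 2 * ((θ.alpha - m) ⬝ᵥ (C *ᵥ (θ.alpha - m)))) by ring]
  ring

/-! ### Measurability -/

theorem measurableSet_Theta : MeasurableSet (Theta q r p) :=
  (measurableSet_posDef r).preimage (measurable_snd.comp measurable_snd)

/-- Cramer's rule writes Σ⁻¹ as the inverse determinant times the adjugate, whose entries are
polynomial in Σ. -/
theorem Data.measurable_wishartKernel (d : Data n q r p) (a : ℝ) (D : Matrix (Fin r) (Fin r) ℝ) :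
    Measurable (d.wishartKernel a D) := by
  have hS : Continuous fun θ : Param q r p => θ.Sig :=
    continuous_matrix fun i j => by
      simp only [Param.Sig, symmetricMatrix, Matrix.of_apply]
      fun_prop
  have hA : Continuous fun θ : Param q r p => θ.calA :=
    continuous_matrix fun i j => by
      simp only [Param.calA, unvec, Matrix.of_apply]
      fun_prop
  have hB : Continuous fun θ : Param q r p => θ.calB :=
    continuous_matrix fun i j => by
      simp only [Param.calB, Matrix.of_apply]
      fun_prop
  have hR : Continuous fun θ : Param q r p => d.resid θ :=
    (continuous_const.sub (continuous_const.matrix_mul hA)).sub (continuous_const.matrix_mul hB)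
  have hdet : Measurable fun θ : Param q r p => θ.Sig.det := hS.matrix_det.measurable
  have htr : Measurable fun θ : Param q r p =>
      (θ.Sig.adjugate * (D + (d.resid θ)ᵀ * d.resid θ)).trace :=
    (hS.matrix_adjugate.matrix_mul
      (continuous_const.add (hR.matrix_transpose.matrix_mul hR))).matrix_trace.measurable
  have heq : d.wishartKernel a D = fun θ => θ.Sig.det ^ (-((n : ℝ) + a) / 2) *
      Real.exp (-(1 / 2) * (θ.Sig.det⁻¹ *
        (θ.Sig.adjugate * (D + (d.resid θ)ᵀ * d.resid θ)).trace)) := by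
    ext θ
    rw [Data.wishartKernel, Matrix.inv_def, Ring.inverse_eq_inv', Matrix.smul_mul,
      Matrix.trace_smul, smul_eq_mul]
  rw [heq]
  fun_prop

theorem Data.wishartKernel_pos (d : Data n q r p) (a : ℝ) (D : Matrix (Fin r) (Fin r) ℝ)
    {θ : Param q r p} (hθ : θ ∈ Theta q r p) : 0 < d.wishartKernel a D θ :=
  mul_pos (Real.rpow_pos_of_pos (Matrix.PosDef.det_pos hθ) _) (Real.exp_pos _)

theorem Data.lintegral_wishartKernel_pos (d : Data n q r p) (a : ℝ)
    (D : Matrix (Fin r) (Fin r) ℝ) {fα : (AlphaIdx q r → ℝ) → ℝ} (hfα : IsPriorDensity fα) :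
    0 < ∫⁻ θ in Theta q r p, ENNReal.ofReal (fα θ.alpha * d.wishartKernel a D θ) := by
  obtain ⟨hm, h0, hne⟩ := hfα
  have hmα : Measurable fun θ : Param q r p => fα θ.alpha := hm.comp measurable_fst
  have hmeas : Measurable fun θ : Param q r p =>
      ENNReal.ofReal (fα θ.alpha * d.wishartKernel a D θ) :=
    (hmα.mul (d.measurable_wishartKernel a D)).ennreal_ofReal
  rw [setLIntegral_pos_iff hmeas]
  have hsub : {α | fα α ≠ 0} ×ˢ ((Set.univ : Set (Fin p → Fin r → ℝ)) ×ˢ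
      {s : UpperIdx r → ℝ | (symmetricMatrix s).PosDef}) ⊆
      (Function.support fun θ : Param q r p =>
        ENNReal.ofReal (fα θ.alpha * d.wishartKernel a D θ)) ∩ Theta q r p := by
    rintro ⟨α, B, s⟩ ⟨hα, -, hs⟩
    refine ⟨?_, hs⟩
    have := d.wishartKernel_pos a D (θ := (α, B, s)) hs
    have h1 : 0 < fα α := lt_of_le_of_ne (h0 α) (Ne.symm hα)
    simp only [Function.mem_support, ne_eq, ENNReal.ofReal_eq_zero, not_le]
    exact mul_pos h1 this
  refine lt_of_lt_of_le ?_ (measure_mono hsub)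
  have hv : (volume : Measure (Param q r p)) = volume.prod (volume.prod volume) := rfl
  rw [hv, Measure.prod_prod, Measure.prod_prod]
  -- By definition, failing to vanish almost everywhere says that {fα ≠ 0} has nonzero measure.
  refine ENNReal.mul_pos hne (mul_ne_zero ?_ ?_)
  · exact (isOpen_univ.measure_pos _ Set.univ_nonempty).ne'
  · have ho := isOpen_setOf_posDef (M := fun s : UpperIdx r → ℝ => symmetricMatrix s)
      (continuous_matrix fun i j => continuous_apply _)
      (fun s => by ext i j; simp [symmetricMatrix, min_comm, max_comm])
    refine (ho.measure_pos _ ⟨fun ij => if ij.1.1 = ij.1.2 then 1 else 0, ?_⟩).ne'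
    have : symmetricMatrix (fun ij : UpperIdx r => if ij.1.1 = ij.1.2 then (1 : ℝ) else 0) = 1 := by
      ext i j
      simp [symmetricMatrix, Matrix.one_apply]
    rw [Set.mem_ofPred_eq, this]
    exact Matrix.PosDef.one

/-! ### Finiteness of the evidence -/

theorem invWishartKernel_mul_det {ι : Type*} [Fintype ι] [DecidableEq ι] (k δ b : ℝ)
    {V : Matrix ι ι ℝ} (hV : V.PosDef) :
    invWishartKernel k δ V * ENNReal.ofReal (V.det ^ (b / 2)) = invWishartKernel (k - b) δ V := by
  have hd := hV.det_pos
  rw [invWishartKernel, invWishartKernel, ← ENNReal.ofReal_mul (by positivity),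
    show -(k - b) / 2 = -k / 2 + b / 2 by ring, Real.rpow_add hd]
  congr 1
  ring

/-- The unnormalized density of the matrix normal distribution of a coefficient matrix. -/
def matrixNormalKernel {κ ι : Type*} [Fintype κ] [Fintype ι] [DecidableEq ι] (c : ℝ)
    (V : Matrix ι ι ℝ) (Δ : Matrix κ ι ℝ) : ℝ≥0∞ :=
  ENNReal.ofReal (Real.exp (-c * (V⁻¹ * (Δᵀ * Δ)).trace))

theorem exists_lintegral_matrixNormalKernel {E : Type*} [NormedAddCommGroup E] [NormedSpace ℝ E]
    [MeasurableSpace E] [BorelSpace E] [FiniteDimensional ℝ E] (μ : Measure E)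
    [μ.IsAddHaarMeasure] {κ ι : Type*} [Fintype κ] [Fintype ι] [DecidableEq ι]
    (e : E ≃ₗ[ℝ] (κ → ι → ℝ)) {c : ℝ} (hc : 0 < c) :
    ∃ K : ℝ≥0∞, K ≠ ∞ ∧ ∀ V : Matrix ι ι ℝ, V.PosDef → ∀ M₀ : Matrix κ ι ℝ,
      ∫⁻ x, matrixNormalKernel c V (Matrix.of (e x) - M₀) ∂μ =
      K * ENNReal.ofReal (V.det ^ ((Fintype.card κ : ℝ) / 2)) := by
  obtain ⟨K, hK, h⟩ := exists_lintegral_matrixNormal μ e hc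
  refine ⟨K, hK, fun V hV M₀ => ?_⟩
  obtain ⟨L, hL, hVL⟩ := PosDef.exists_eq_transpose_mul_self hV.inv
  simp only [matrixNormalKernel, hVL]
  rw [h L hL M₀]
  congr 2
  have hd := hV.det_pos
  have h1 : |L.det|⁻¹ = Real.sqrt V.det := by
    have := congrArg Matrix.det hVL
    rw [Matrix.det_mul, Matrix.det_transpose, Matrix.det_nonsing_inv, Ring.inverse_eq_inv'] at this
    rw [← inv_inv V.det, this, Real.sqrt_inv, Real.sqrt_mul_self_eq_abs]
  rw [h1, Real.sqrt_eq_rpow, ← Real.rpow_mul_natCast hd.le]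
  congr 1
  ring

/-- The Gaussian integral over ℬ does not depend on its centre and equals a constant times
|Σ|^{p/2}, so J is uniform in M₀ and k drops to k - p > 2r. -/
theorem exists_lintegral_calB_Sig_le (p r : ℕ) {k δ c : ℝ} (hk : 2 * (r : ℝ) + p < k)
    (hδ : 0 < δ) (hc : 0 < c) :
    ∃ J : ℝ≥0∞, J ≠ ∞ ∧ ∀ M₀ : Matrix (Fin p) (Fin r) ℝ,
      ∫⁻ z : (Fin p → Fin r → ℝ) × (UpperIdx r → ℝ),
        {s : UpperIdx r → ℝ | (symmetricMatrix s).PosDef}.indicator (fun s =>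
          invWishartKernel k δ (symmetricMatrix s) *
            matrixNormalKernel c (symmetricMatrix s) (Matrix.of z.1 - M₀)) z.2 ≤ J := by
  obtain ⟨K, hK, h⟩ := exists_lintegral_matrixNormalKernel
    (volume : Measure (Fin p → Fin r → ℝ)) (LinearEquiv.refl ℝ _) hc
  refine ⟨K * _, ENNReal.mul_ne_top hK
    (lintegral_invWishartKernel_lt_top r (k := k - p) (by linarith) hδ).ne, fun M₀ => ?_⟩
  rw [← lintegral_const_mul' _ _ hK, ← lintegral_indicator (measurableSet_posDef _)]
  refine (lintegral_prod_symm_le _).trans (lintegral_mono fun s => ?_)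
  by_cases hs : (symmetricMatrix s).PosDef
  swap
  · simp [hs]
  simp only [Set.mem_ofPred_eq, hs, Set.indicator_of_mem]
  have hne : invWishartKernel k δ (symmetricMatrix s) ≠ ∞ := ENNReal.ofReal_ne_top
  have h2 := h _ hs M₀
  simp only [LinearEquiv.refl_apply] at h2
  rw [lintegral_const_mul' _ _ hne, h2, Fintype.card_fin, mul_left_comm,
    invWishartKernel_mul_det _ _ _ hs]

/-- Reduces both finiteness proofs to a trace inequality; the factors 2 absorb the 1/2 in the
exponent, which is why δ and c are halved in the applications. -/
theorem Data.wishartKernel_le (d : Data n q r p) (a : ℝ) (D : Matrix (Fin r) (Fin r) ℝ)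
    {θ : Param q r p} (hθ : θ ∈ Theta q r p) {δ x : ℝ}
    (h : 2 * δ * θ.Sig⁻¹.trace + 2 * x ≤ (θ.Sig⁻¹ * (D + (d.resid θ)ᵀ * d.resid θ)).trace) :
    ENNReal.ofReal (d.wishartKernel a D θ) ≤
      invWishartKernel (n + a) δ θ.Sig * ENNReal.ofReal (Real.exp (-x)) := by
  have hd : 0 < θ.Sig.det := Matrix.PosDef.det_pos hθ
  rw [invWishartKernel, ← ENNReal.ofReal_mul (by positivity), mul_assoc, ← Real.exp_add]
  refine ENNReal.ofReal_le_ofReal ?_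
  rw [Data.wishartKernel]
  gcongr
  linarith

/-- The evidence is finite if `D` is positive definite, `X` has full column rank and the prior of
`α` is proper. -/
theorem Data.lintegral_wishartKernel_lt_top_of_proper (d : Data n q r p) {a : ℝ}
    {D : Matrix (Fin r) (Fin r) ℝ} {fα : (AlphaIdx q r → ℝ) → ℝ} (hD : D.PosDef)
    (hX : FullColumnRank d.X) (hk : 2 * (r : ℝ) + p < n + a) (hfα : IsProperDensity fα) :
    ∫⁻ θ in Theta q r p, ENNReal.ofReal (fα θ.alpha * d.wishartKernel a D θ) < ∞ := by
  obtain ⟨δ, hδ, hDδ⟩ := exists_pos_sub_smul_one_posDef hD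
  obtain ⟨c, hc, hls⟩ := exists_leastSquares (ι := Fin r) hX
  -- The estimate B₀ moves with α, but no regularity in α is needed since the bound J holds for
  -- every centre.
  choose B₀ hB₀ using hls
  obtain ⟨J, hJ, hJe⟩ := exists_lintegral_calB_Sig_le p r hk (half_pos hδ) (half_pos hc)
  have hv : (volume : Measure (Param q r p)) = volume.prod (volume.prod volume) := rfl
  rw [← lintegral_indicator measurableSet_Theta]
  calc _ ≤ ∫⁻ θ : Param q r p, ENNReal.ofReal (fα θ.alpha) *
        {s : UpperIdx r → ℝ | (symmetricMatrix s).PosDef}.indicator (fun s =>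
          invWishartKernel (n + a) (δ / 2) (symmetricMatrix s) *
            matrixNormalKernel (c / 2) (symmetricMatrix s)
              (Matrix.of θ.2.1 - B₀ (d.Y - d.Z * unvec θ.1))) θ.2.2 := by
        refine lintegral_mono fun θ => ?_
        by_cases hθ : θ ∈ Theta q r p
        swap
        · simp [hθ]
        have hs : (symmetricMatrix θ.2.2).PosDef := hθ
        rw [Set.indicator_of_mem hθ, Set.indicator_of_mem (by exact hs),
          ENNReal.ofReal_mul (hfα.1.2.1 _)]
        gcongr
        rw [matrixNormalKernel, neg_mul]
        refine d.wishartKernel_le a D hθ ?_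
        have hP := hs.inv.posSemidef
        have h1 := mul_trace_le_trace_mul hP hDδ.posSemidef
        have h2 := hB₀ (d.Y - d.Z * unvec θ.1) _ hP (Matrix.of θ.2.1)
        -- The minimal residual sum of squares is discarded here: D alone controls tr Σ⁻¹.
        have h3 := PosSemidef.trace_mul_nonneg hP (Matrix.posSemidef_conjTranspose_mul_self
          (d.Y - d.Z * unvec θ.1 - d.X * B₀ (d.Y - d.Z * unvec θ.1)))
        rw [Matrix.conjTranspose_eq_transpose_of_trivial] at h3
        simp only [Param.Sig, Data.resid, Param.calA, Param.calB]
        rw [Matrix.mul_add, Matrix.trace_add]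
        linarith
    _ ≤ ∫⁻ α, ENNReal.ofReal (fα α) * J := by
        rw [hv]
        refine (lintegral_prod_le _).trans (lintegral_mono fun α => ?_)
        simp only [Param.alpha]
        rw [lintegral_const_mul' _ _ ENNReal.ofReal_ne_top]
        gcongr
        exact hJe _
    _ < ∞ := by
        rw [lintegral_mul_const' _ _ hJ]
        exact ENNReal.mul_lt_top hfα.2 hJ.lt_top

/-- Unvectorization as a linear equivalence. -/
def unvecEquiv (q r : ℕ) : (AlphaIdx q r → ℝ) ≃ₗ[ℝ] (Fin q × Fin r → Fin r → ℝ) where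
  toFun α ij k := α (k, ij)
  invFun A kij := A kij.2 kij.1
  map_add' _ _ := rfl
  map_smul' _ _ := rfl
  left_inv _ := rfl
  right_inv _ := rfl

/-- The evidence is finite if `[Y, Z, X]` has full column rank and the prior of `α` is bounded. -/
theorem Data.lintegral_wishartKernel_lt_top_of_bounded (d : Data n q r p) {a : ℝ}
    {D : Matrix (Fin r) (Fin r) ℝ} {fα : (AlphaIdx q r → ℝ) → ℝ} (hD : D.PosSemidef)
    (hYZX : FullColumnRank d.YZX) (hk : (2 + (q : ℝ)) * r + p < n + a)
    {M : ℝ} (hM : ∀ α, fα α ≤ M) :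
    ∫⁻ θ in Theta q r p, ENNReal.ofReal (fα θ.alpha * d.wishartKernel a D θ) < ∞ := by
  have hZX : FullColumnRank (Matrix.fromCols d.Z d.X) :=
    LinearIndependent.comp hYZX Sum.inr Sum.inr_injective
  obtain ⟨c, hc, hls⟩ := exists_leastSquares (ι := Fin r) hZX
  obtain ⟨Γ₀, hΓ₀⟩ := hls d.Y
  have hR := posDef_residual hYZX Γ₀
  obtain ⟨δ, hδ, hDδ⟩ := exists_pos_sub_smul_one_posDef (hR.posSemidef_add hD)
  obtain ⟨K, hK, hKe⟩ := exists_lintegral_matrixNormalKernel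
    (volume : Measure (AlphaIdx q r → ℝ)) (unvecEquiv q r) (half_pos hc)
  -- The qr rows of 𝒜, integrated first, contribute |Σ|^{qr/2} and lower the parameter by qr.
  obtain ⟨J, hJ, hJe⟩ := exists_lintegral_calB_Sig_le p r (k := n + a - (q * r : ℕ))
    (by push_cast; linarith) (half_pos hδ) (half_pos hc)
  have hv : (volume : Measure (Param q r p)) = volume.prod (volume.prod volume) := rfl
  rw [← lintegral_indicator measurableSet_Theta]
  calc _ ≤ ∫⁻ θ : Param q r p, ENNReal.ofReal M *
        {s : UpperIdx r → ℝ | (symmetricMatrix s).PosDef}.indicator (fun s =>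
          invWishartKernel (n + a) (δ / 2) (symmetricMatrix s) *
            (matrixNormalKernel (c / 2) (symmetricMatrix s) (Matrix.of θ.2.1 - Γ₀.toRows₂) *
            matrixNormalKernel (c / 2) (symmetricMatrix s)
              (Matrix.of (unvecEquiv q r θ.1) - Γ₀.toRows₁))) θ.2.2 := by
        refine lintegral_mono fun θ => ?_
        by_cases hθ : θ ∈ Theta q r p
        swap
        · simp [hθ]
        have hs : (symmetricMatrix θ.2.2).PosDef := hθ
        rw [Set.indicator_of_mem hθ, Set.indicator_of_mem (by exact hs),
          ENNReal.ofReal_mul' (d.wishartKernel_pos a D hθ).le]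
        gcongr
        · exact hM _
        rw [matrixNormalKernel, matrixNormalKernel, ← ENNReal.ofReal_mul (Real.exp_pos _).le,
          ← Real.exp_add, neg_mul, neg_mul, ← neg_add]
        refine d.wishartKernel_le a D hθ ?_
        have hP := hs.inv.posSemidef
        have h1 := mul_trace_le_trace_mul hP hDδ.posSemidef
        -- Splitting Γ - Γ₀ into its 𝒜 and ℬ rows makes the squared distance a sum, so the Gaussian
        -- factors into one in α and one in ℬ.
        have h2 := hΓ₀ _ hP (Matrix.fromRows (unvec θ.1) (Matrix.of θ.2.1))
        have h3 : Matrix.fromRows (unvec θ.1) (Matrix.of θ.2.1) - Γ₀ =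
            Matrix.fromRows (unvec θ.1 - Γ₀.toRows₁) (Matrix.of θ.2.1 - Γ₀.toRows₂) := by
          ext (i | i) j <;> rfl
        rw [h3, Matrix.transpose_fromRows, Matrix.fromCols_mul_fromRows,
          Matrix.fromCols_mul_fromRows, Matrix.mul_add _ (_ * _) (_ * _), Matrix.trace_add,
          ← sub_sub] at h2
        rw [Matrix.mul_add, Matrix.trace_add] at h1
        have h4 : Matrix.of (unvecEquiv q r θ.1) = unvec θ.1 := rfl
        simp only [Param.Sig, Data.resid, Param.calA, Param.calB, h4]
        rw [Matrix.mul_add, Matrix.trace_add]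
        linarith
    _ ≤ ∫⁻ z : (Fin p → Fin r → ℝ) × (UpperIdx r → ℝ), ENNReal.ofReal M * (K *
        {s : UpperIdx r → ℝ | (symmetricMatrix s).PosDef}.indicator (fun s =>
          invWishartKernel (n + a - (q * r : ℕ)) (δ / 2) (symmetricMatrix s) *
            matrixNormalKernel (c / 2) (symmetricMatrix s)
              (Matrix.of z.1 - Γ₀.toRows₂)) z.2) := by
        rw [hv]
        refine (lintegral_prod_symm_le _).trans (lintegral_mono fun z => ?_)
        simp only
        rw [lintegral_const_mul' _ _ ENNReal.ofReal_ne_top]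
        gcongr
        by_cases hs : (symmetricMatrix z.2).PosDef
        swap
        · simp [hs]
        simp only [Set.mem_ofPred_eq, hs, Set.indicator_of_mem]
        have hne : invWishartKernel (n + a) (δ / 2) (symmetricMatrix z.2) ≠ ∞ :=
          ENNReal.ofReal_ne_top
        have hne' : matrixNormalKernel (c / 2) (symmetricMatrix z.2)
          (Matrix.of z.1 - Γ₀.toRows₂) ≠ ∞ := ENNReal.ofReal_ne_top
        rw [lintegral_const_mul' _ _ hne, lintegral_const_mul' _ _ hne', hKe _ hs,
          ← invWishartKernel_mul_det _ _ _ hs, Fintype.card_prod, Fintype.card_fin,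
          Fintype.card_fin]
        refine le_of_eq ?_
        ring
    _ < ∞ := by
        rw [lintegral_const_mul' _ _ ENNReal.ofReal_ne_top, lintegral_const_mul' _ _ hK]
        exact ENNReal.mul_lt_top ENNReal.ofReal_lt_top
          (ENNReal.mul_lt_top hK.lt_top ((hJe _).trans_lt hJ.lt_top))

/-! ### The posterior distribution -/

theorem isProbabilityMeasure_posterior {lik prior : Param q r p → ℝ}
    (h : PosteriorProper lik prior) : IsProbabilityMeasure (posterior lik prior) := by
  obtain ⟨h0, h1⟩ := h
  refine ⟨?_⟩
  have hpos : 0 < (evidence lik prior).toReal := ENNReal.toReal_pos h0.ne' h1.ne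
  rw [posterior, withDensity_apply _ MeasurableSet.univ, Measure.restrict_univ]
  simp_rw [posteriorDensity, ENNReal.ofReal_div_of_pos hpos, ENNReal.ofReal_toReal h1.ne,
    div_eq_mul_inv]
  rw [lintegral_mul_const' _ _ (ENNReal.inv_ne_top.2 h0.ne')]
  exact ENNReal.mul_inv_cancel h0.ne' h1.ne

end VARX

end

theorem mainTheorem4 {n q r p : ℕ} (d : VARX.Data n q r p)
    (fX : Matrix (Fin n) (Fin p) ℝ → ℝ) (hfX : 0 < fX d.X)
    (a : ℝ) (ha : 0 ≤ a) (D : Matrix (Fin r) (Fin r) ℝ) (hD : D.PosSemidef)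
    (fα : (VARX.AlphaIdx q r → ℝ) → ℝ) (hfα : VARX.IsPriorDensity fα)
    (fB : Matrix (Fin p) (Fin r) ℝ → ℝ)
    (hfB : VARX.ProportionalOn Set.univ fB (fun _ => 1))
    (fS : Matrix (Fin r) (Fin r) ℝ → ℝ)
    (hfS : VARX.ProportionalOn {V | V.PosDef} fS (VARX.covPriorKernel a D))
    (hcond :
      (D.PosDef ∧ VARX.FullColumnRank d.X ∧ 2 * (r : ℝ) + p < n + a ∧
        VARX.IsProperDensity fα) ∨
      (VARX.FullColumnRank d.YZX ∧ (2 + (q : ℝ)) * r + p < n + a ∧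
        ∃ M : ℝ, ∀ α, fα α ≤ M)) :
    (VARX.PosteriorProper (d.likelihood fX) (VARX.priorDensity fα fB fS) ∧
      MeasureTheory.IsProbabilityMeasure
        (VARX.posterior (d.likelihood fX) (VARX.priorDensity fα fB fS))) ∧
    ∀ (m : VARX.AlphaIdx q r → ℝ)
      (C : Matrix (VARX.AlphaIdx q r) (VARX.AlphaIdx q r) ℝ), C.PosSemidef →
      VARX.ProportionalOn Set.univ fα (VARX.normalPriorKernel m C) →
      VARX.ProportionalOn (VARX.Theta q r p)
        (VARX.posteriorDensity (d.likelihood fX) (VARX.priorDensity fα fB fS))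
        (d.posteriorKernel a D m C) := by
  obtain ⟨c, hc, hlp⟩ := d.likelihood_mul_prior hfX fα hfB hfS
  have hev : VARX.evidence (d.likelihood fX) (VARX.priorDensity fα fB fS) =
      ENNReal.ofReal c * ∫⁻ θ in VARX.Theta q r p,
        ENNReal.ofReal (fα θ.alpha * d.wishartKernel a D θ) := by
    rw [VARX.evidence, ← MeasureTheory.lintegral_const_mul' _ _ ENNReal.ofReal_ne_top]
    refine MeasureTheory.setLIntegral_congr_fun VARX.measurableSet_Theta fun θ hθ => ?_
    simp only [hlp θ hθ, ENNReal.ofReal_mul hc.le]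
  have hproper : VARX.PosteriorProper (d.likelihood fX) (VARX.priorDensity fα fB fS) := by
    rw [VARX.PosteriorProper, hev]
    refine ⟨ENNReal.mul_pos (ENNReal.ofReal_pos.2 hc).ne'
      (d.lintegral_wishartKernel_pos a D hfα).ne', ENNReal.mul_lt_top ENNReal.ofReal_lt_top ?_⟩
    rcases hcond with ⟨hDpos, hX, hk, hprop⟩ | ⟨hYZX, hk, M, hM⟩
    · exact d.lintegral_wishartKernel_lt_top_of_proper hDpos hX hk hprop
    · exact d.lintegral_wishartKernel_lt_top_of_bounded hD hYZX hk hM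
  refine ⟨⟨hproper, VARX.isProbabilityMeasure_posterior hproper⟩, ?_⟩
  rintro m C - ⟨cα, hcα, hα⟩
  have hpos := ENNReal.toReal_pos hproper.1.ne' hproper.2.ne
  refine ⟨c * cα / (VARX.evidence (d.likelihood fX) (VARX.priorDensity fα fB fS)).toReal,
    by positivity, fun θ hθ => ?_⟩
  rw [VARX.posteriorDensity, hlp θ hθ, hα _ (Set.mem_univ _), d.posteriorKernel_eq]
  ring
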